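/- Let $R$ be an integral domain. A commutative unital $R$-algebra $S$ is a *Specker $R$-algebra* if the Boolean algebra $\mathrm{Id}(S)$ of idempotents of $S$ (with $e\wedge f=ef$, $e\vee f=e+f-ef$, $\neg e=1-e$) has a Boolean subalgebra $B$ that generates $S$ as an $R$-algebra and is such that, for every nonzero $e\in B$ and every $a\in R$, $ae=0$ implies $a=0$. Let $\mathbf{Sp}_R$ be the category of Specker $R$-algebras and unital $R$-algebra homomorphisms. Then an object $S$ of $\mathbf{Sp}_R$ is injective (that is, for every monomorphism $f:X\to Y$ and every morphism $g:X\to S$ in $\mathbf{Sp}_R$ there is a morphism $h:Y\to S$ with $h\circ f=g$) if and only if $S$ is a Baer ring, i.e. the annihilator of every subset of $S$ is a principal ideal generated by an idempotent. -/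

import Mathlib

open CategoryTheory

universe v u

namespace Specker

/-- An idempotent `e` of the `R`-algebra `S` is faithful if it is nonzero and `a • e = 0` with
`a : R` forces `a = 0`. -/
def IsFaithfulIdempotent (R : Type*) {S : Type*} [CommRing R] [CommRing S] [Algebra R S]
    (e : {x : S // IsIdempotentElem x}) : Prop :=
  e ≠ ⊥ ∧ ∀ a : R, a • (e : S) = 0 → a = 0

/-- `B`, a Boolean subalgebra of the Boolean algebra of idempotents of `S` (with `e ⊓ f = e * f`,
`e ⊔ f = e + f - e * f`, `eᶜ = 1 - e`), is a faithful generating algebra of idempotents of `S`: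
it generates `S` as an `R`-algebra, and each of its nonzero elements is faithful. -/
structure IsFaithfulGenerating (R : Type*) {S : Type*} [CommRing R] [CommRing S] [Algebra R S]
    (B : BooleanSubalgebra {x : S // IsIdempotentElem x}) : Prop where
  adjoin_eq_top :
    Algebra.adjoin R ((fun e : {x : S // IsIdempotentElem x} => (e : S)) '' (B : Set _)) = ⊤
  faithful : ∀ e ∈ B, e ≠ ⊥ → IsFaithfulIdempotent R e

/-- A Specker `R`-algebra is a commutative `R`-algebra that has a faithful generating algebra of
idempotents. -/
def IsSpeckerAlgebra (R : Type*) (S : Type*) [CommRing R] [CommRing S] [Algebra R S] : Prop :=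
  ∃ B : BooleanSubalgebra {x : S // IsIdempotentElem x}, IsFaithfulGenerating R B

/-- A commutative ring is a Baer ring if the annihilator of each subset is a principal ideal
generated by an idempotent. -/
def IsBaerRing (S : Type*) [CommRing S] : Prop :=
  ∀ I : Set S, ∃ e : S, IsIdempotentElem e ∧
    {x : S | ∀ s ∈ I, x * s = 0} = (Ideal.span {e} : Ideal S)

/-- The category of Specker `R`-algebras and (unital) `R`-algebra homomorphisms, as a full
subcategory of the category of commutative `R`-algebras. -/
abbrev SpeckerAlgCat (R : Type u) [CommRing R] : Type (max u (v + 1)) :=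
  ObjectProperty.FullSubcategory (fun S : CommAlgCat.{v, u} R => IsSpeckerAlgebra R S)

end Specker

/-!
Both directions rest on an extension theorem which is Sikorski's theorem in ring form
(`exists_algHom_of_isBaerRing`): if `S` is a Baer `R`-algebra and `Y` is generated by idempotents,
then every partial homomorphism from `Y` to `S` extends to all of `Y`. A partial homomorphism is
encoded by its graph, a subalgebra `G` of `Y × S` whose only element with first coordinate `0` is
`0`; Zorn's lemma gives a maximal such `G`. If `e` is an idempotent of `Y`, let `t` be the
idempotent generating the annihilator of the image under `G` of the annihilator of `e`. Then `(e, t)`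
can be adjoined to `G`, because the annihilators of `e` and `1 - e` have product zero. So the domain
of a maximal `G` contains all idempotents.

If `S` is Baer, it is injective as soon as monomorphisms of Specker algebras are injective maps.
Over a domain, each nonzero `x` in a Specker algebra satisfies `x * d = r • d` for some nonzero
idempotent `d` and some nonzero scalar `r` (`IsSpeckerAlgebra.exists_mul_eq_smul`). Hence Specker
algebras are torsion-free, and a homomorphism is injective once it kills no nonzero idempotent;
idempotents of `X` are the same as maps from the Specker algebra `R × R` to `X`.

Conversely, an injective `S` is a retract of every Specker algebra that contains it, and retracts
of Baer rings are Baer. It therefore suffices to embed `S` in a Baer Specker algebra. Let `K` be the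
copy of `R` inside `S` and `P` the set of homomorphisms `S → K`. Since `K` is a domain, it is Baer,
and the extension theorem shows that `P` separates the points of `S`; so evaluation embeds `S` in
the subalgebra of `P → K` generated by all idempotents, which is Baer because every subset of `P`
has an indicator function. Using `K` and not `R` keeps these algebras in the universe of `S`.
-/

namespace Specker

/-! ### Extending partial homomorphisms into Baer rings -/

section Extension

variable {R : Type*} [CommRing R]

/-- The subalgebra of those `x` that agree with an element of `G` after multiplication by `w`, and
with another one after multiplication by `1 - w`. For idempotent `w` this is `G[w]`. -/
def glue {A : Type*} [CommRing A] [Algebra R A] (G : Subalgebra R A) (w : A) :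
    Subalgebra R A where
  carrier := {x | ∃ p ∈ G, ∃ q ∈ G, x * w = p * w ∧ x * (1 - w) = q * (1 - w)}
  mul_mem' := by
    rintro x y ⟨p, hp, q, hq, h1, h2⟩ ⟨p', hp', q', hq', h1', h2'⟩
    refine ⟨p * p', mul_mem hp hp', q * q', mul_mem hq hq', ?_, ?_⟩
    · linear_combination y * h1 + p * h1'
    · linear_combination y * h2 + q * h2'
  add_mem' := by
    rintro x y ⟨p, hp, q, hq, h1, h2⟩ ⟨p', hp', q', hq', h1', h2'⟩
    refine ⟨p + p', add_mem hp hp', q + q', add_mem hq hq', ?_, ?_⟩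
    · linear_combination h1 + h1'
    · linear_combination h2 + h2'
  algebraMap_mem' r := ⟨_, G.algebraMap_mem r, _, G.algebraMap_mem r, rfl, rfl⟩

lemma le_glue {A : Type*} [CommRing A] [Algebra R A] (G : Subalgebra R A) (w : A) :
    G ≤ glue G w :=
  fun x hx => ⟨x, hx, x, hx, rfl, rfl⟩

lemma mem_glue_self {A : Type*} [CommRing A] [Algebra R A] (G : Subalgebra R A) {w : A}
    (hw : IsIdempotentElem w) : w ∈ glue G w :=
  ⟨1, one_mem _, 0, zero_mem _, by rw [hw.eq, one_mul], by rw [mul_sub, hw.eq]; simp⟩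

variable {Y S : Type*} [CommRing Y] [Algebra R Y] [CommRing S] [Algebra R S]

/-- A subalgebra of `Y × S` is single-valued if it is the graph of a homomorphism from a
subalgebra of `Y` to `S`. -/
def IsSingleValued (G : Subalgebra R (Y × S)) : Prop :=
  ∀ s : S, ((0, s) : Y × S) ∈ G → s = 0

/-- If `S` is Baer, a single-valued graph can be enlarged by a pair `(e, t)`, for any given `e`. -/
lemma IsSingleValued.exists_glue (hS : IsBaerRing S) {G : Subalgebra R (Y × S)}
    (hG : IsSingleValued G) (e : Y) :
    ∃ t : S, IsIdempotentElem t ∧ IsSingleValued (glue G (e, t)) := by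
  obtain ⟨t, ht, hann⟩ := hS {s | ∃ a : Y, (a, s) ∈ G ∧ a * e = 0}
  have mem_iff : ∀ x : S, (∀ s, ∀ a : Y, (a, s) ∈ G → a * e = 0 → x * s = 0) ↔ t ∣ x := by
    intro x
    have := Set.ext_iff.mp hann x
    simp only [Set.mem_ofPred_eq, SetLike.mem_coe, Ideal.mem_span_singleton] at this
    rw [← this]
    exact ⟨fun h s ⟨a, h1, h2⟩ => h s a h1 h2, fun h s a h1 h2 => h s ⟨a, h1, h2⟩⟩
  refine ⟨t, ht, ?_⟩
  rintro s ⟨⟨a, p⟩, hp, ⟨b, q⟩, hq, h1, h2⟩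
  simp only [Prod.mk_mul_mk, Prod.snd_sub, Prod.fst_sub, Prod.ext_iff,
    Prod.fst_mul, Prod.snd_mul, Prod.fst_one, Prod.snd_one, zero_mul] at h1 h2
  have hpt : p * t = 0 := by
    rw [mul_comm]
    exact (mem_iff t).mpr dvd_rfl p a hp h1.1.symm
  have hqt : q * (1 - t) = 0 := by
    -- `q` annihilates the image of the annihilator of `e`, since `b` does so in `Y`.
    obtain ⟨c, rfl⟩ : t ∣ q := by
      refine (mem_iff q).mp fun s' a' hs' ha' => hG _ ?_
      have hba : b * a' = 0 := by linear_combination b * ha' - a' * h2.1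
      have := mul_mem hq hs'
      rwa [Prod.mk_mul_mk, hba] at this
    linear_combination -c * ht.eq
  linear_combination h1.2 + h2.2 + hpt + hqt

/-- A partial homomorphism from an algebra generated by idempotents to a Baer algebra extends to a
total one. -/
theorem exists_algHom_of_isBaerRing (hS : IsBaerRing S)
    (hY : Algebra.adjoin R {e : Y | IsIdempotentElem e} = ⊤)
    {G₀ : Subalgebra R (Y × S)} (hG₀ : IsSingleValued G₀) :
    ∃ h : Y →ₐ[R] S, ∀ p ∈ G₀, h p.1 = p.2 := by
  obtain ⟨G, hle, hmax⟩ := zorn_le_nonempty₀ {G : Subalgebra R (Y × S) | IsSingleValued G}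
    (by
      intro c hc hchain G hGc
      have : Nonempty c := ⟨⟨G, hGc⟩⟩
      refine ⟨⨆ i : c, (i : Subalgebra R (Y × S)), fun s hs => ?_,
        fun z hz => le_iSup (fun i : c => (i : Subalgebra R (Y × S))) ⟨z, hz⟩⟩
      rw [← SetLike.mem_coe,
        Subalgebra.coe_iSup_of_directed hchain.directedOn.directed_val] at hs
      obtain ⟨i, hi⟩ := Set.mem_iUnion.mp hs
      exact hc i.2 s hi)
    G₀ hG₀
  have hG : IsSingleValued G := hmax.prop
  let π : G →ₐ[R] Y := (AlgHom.fst R Y S).comp G.val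
  have hπ : Function.Bijective π := by
    constructor
    · rw [injective_iff_map_eq_zero]
      rintro ⟨⟨a, s⟩, hp⟩ (rfl : a = 0)
      exact Subtype.ext (Prod.ext rfl (hG s hp))
    · rw [← AlgHom.range_eq_top, ← top_le_iff, ← hY, Algebra.adjoin_le_iff]
      intro e he
      obtain ⟨t, ht, hsv⟩ := hG.exists_glue hS e
      have hidem : IsIdempotentElem ((e, t) : Y × S) := Prod.ext he.eq ht.eq
      exact ⟨⟨(e, t), hmax.le_of_ge hsv (le_glue G _) (mem_glue_self G hidem)⟩, rfl⟩
  let E := AlgEquiv.ofBijective π hπ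
  refine ⟨((AlgHom.snd R Y S).comp G.val).comp E.symm.toAlgHom, fun p hp => ?_⟩
  have : E.symm p.1 = ⟨p, hle hp⟩ := (AlgEquiv.symm_apply_eq E).mpr rfl
  change ((E.symm p.1 : G) : Y × S).2 = p.2
  rw [this]

/-- Baer algebras have the extension property for injective homomorphisms into algebras generated by
idempotents. -/
lemma exists_extension_of_isBaerRing {X : Type*} [CommRing X] [Algebra R X] (hS : IsBaerRing S)
    (hY : Algebra.adjoin R {e : Y | IsIdempotentElem e} = ⊤)
    (f : X →ₐ[R] Y) (hf : Function.Injective f) (g : X →ₐ[R] S) :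
    ∃ h : Y →ₐ[R] S, h.comp f = g := by
  obtain ⟨h, hh⟩ := exists_algHom_of_isBaerRing hS hY (G₀ := (f.prod g).range) <| by
    rintro s ⟨x, hx⟩
    obtain ⟨h1, h2⟩ := Prod.ext_iff.mp hx
    obtain rfl : x = 0 := (injective_iff_map_eq_zero f).mp hf x h1
    exact h2.symm.trans (map_zero g)
  exact ⟨h, AlgHom.ext fun x => hh (f x, g x) ⟨x, rfl⟩⟩

end Extension

/-! ### Specker algebras over a domain -/

section Specker

variable {R : Type*} [CommRing R] {X : Type*} [CommRing X] [Algebra R X]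

lemma IsSpeckerAlgebra.adjoin_isIdempotentElem (hX : IsSpeckerAlgebra R X) :
    Algebra.adjoin R {e : X | IsIdempotentElem e} = ⊤ := by
  obtain ⟨B, hB⟩ := hX
  rw [← top_le_iff, ← hB.adjoin_eq_top]
  apply Algebra.adjoin_mono
  rintro _ ⟨e, -, rfl⟩
  exact e.2

lemma IsSpeckerAlgebra.algebraMap_injective [Nontrivial X] (hX : IsSpeckerAlgebra R X) :
    Function.Injective (algebraMap R X) := by
  obtain ⟨B, hB⟩ := hX
  rw [injective_iff_map_eq_zero]
  refine fun a ha => (hB.faithful ⊤ B.top_mem fun h => ?_).2 a ?_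
  · exact one_ne_zero (congrArg Subtype.val h : (1 : X) = 0)
  · change a • (1 : X) = 0
    rw [← Algebra.algebraMap_eq_smul_one, ha]

/-- Every element of a Specker algebra is scalar on some faithful idempotent that supports it. -/
lemma IsSpeckerAlgebra.exists_mul_eq_smul (hX : IsSpeckerAlgebra R X) {x : X} (hx : x ≠ 0) :
    ∃ d : X, IsIdempotentElem d ∧ (∀ a : R, a • d = 0 → a = 0) ∧
      ∃ r : R, r ≠ 0 ∧ x * d = r • d := by
  obtain ⟨B, hB⟩ := hX
  -- The auxiliary `z` makes the claim stable under passing to smaller idempotents.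
  have key : ∀ x : X, ∀ z : X, z ≠ 0 → ∃ d ∈ B, z * d ≠ 0 ∧ ∃ r : R, x * d = r • (d : X) := by
    intro x
    have hx : x ∈ Algebra.adjoin R
        ((fun e : {x : X // IsIdempotentElem x} => (e : X)) '' (B : Set _)) := by
      rw [hB.adjoin_eq_top]; trivial
    induction hx using Algebra.adjoin_induction with
    | mem b hb =>
      obtain ⟨b, hb, rfl⟩ := hb
      intro z hz
      by_cases h : z * b = 0
      · refine ⟨bᶜ, B.compl_mem hb, ?_, 0, ?_⟩
        · simpa [mul_sub, h] using hz
        · simp [mul_sub, b.2.eq]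
      · exact ⟨b, hb, h, 1, by simp [b.2.eq]⟩
    | algebraMap r =>
      intro z hz
      refine ⟨⊤, B.top_mem, ?_, r, (Algebra.smul_def _ _).symm⟩
      change z * 1 ≠ 0
      rwa [mul_one]
    | add x y _ _ ihx ihy =>
      intro z hz
      obtain ⟨d, hd, hzd, r, hr⟩ := ihx z hz
      obtain ⟨d', hd', hzd', r', hr'⟩ := ihy _ hzd
      refine ⟨d ⊓ d', B.inf_mem hd hd', ?_, r + r', ?_⟩
      · change z * (d * d' : X) ≠ 0
        rwa [← mul_assoc]
      · change (x + y) * (d * d' : X) = (r + r') • (d * d' : X)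
        rw [Algebra.smul_def] at hr hr' ⊢
        rw [map_add]
        linear_combination (d' : X) * hr + (d : X) * hr'
    | mul x y _ _ ihx ihy =>
      intro z hz
      obtain ⟨d, hd, hzd, r, hr⟩ := ihx z hz
      obtain ⟨d', hd', hzd', r', hr'⟩ := ihy _ hzd
      refine ⟨d ⊓ d', B.inf_mem hd hd', ?_, r * r', ?_⟩
      · change z * (d * d' : X) ≠ 0
        rwa [← mul_assoc]
      · change (x * y) * (d * d' : X) = (r * r') • (d * d' : X)
        rw [Algebra.smul_def] at hr hr' ⊢
        rw [map_mul]
        linear_combination (y * d' : X) * hr + (algebraMap R X r * d : X) * hr'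
  obtain ⟨d, hd, hxd, r, hr⟩ := key x x hx
  have hd0 : d ≠ ⊥ := by
    rintro rfl
    exact hxd (mul_zero x)
  refine ⟨d, d.2, (hB.faithful d hd hd0).2, r, ?_, hr⟩
  rintro rfl
  exact hxd (hr.trans (zero_smul R _))

lemma IsSpeckerAlgebra.eq_zero_of_smul_eq_zero [IsDomain R] (hX : IsSpeckerAlgebra R X) {x : X}
    (hx : x ≠ 0) {a : R} (h : a • x = 0) : a = 0 := by
  obtain ⟨d, -, hd, r, hr, hxd⟩ := hX.exists_mul_eq_smul hx
  have : (a * r) • d = 0 := by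
    rw [mul_smul, ← hxd, ← smul_mul_assoc, h, zero_mul]
  exact (mul_eq_zero.mp (hd _ this)).resolve_right hr

lemma IsSpeckerAlgebra.injective_of_idempotents [IsDomain R] {Y : Type*} [CommRing Y] [Algebra R Y]
    (hX : IsSpeckerAlgebra R X) (hY : IsSpeckerAlgebra R Y) (f : X →ₐ[R] Y)
    (hf : ∀ e : X, IsIdempotentElem e → f e = 0 → e = 0) : Function.Injective f := by
  rw [injective_iff_map_eq_zero]
  intro x hx
  by_contra hx0
  obtain ⟨d, hd, hfaith, r, hr, hxd⟩ := hX.exists_mul_eq_smul hx0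
  have hfd : f d ≠ 0 := by
    intro h
    obtain rfl := hf d hd h
    exact hr (hfaith r (smul_zero r))
  apply hr
  apply hY.eq_zero_of_smul_eq_zero hfd
  rw [← map_smul, ← hxd, map_mul, hx, zero_mul]

lemma IsSpeckerAlgebra.isDomain_bot [IsDomain R] [Nontrivial X] (hX : IsSpeckerAlgebra R X) :
    IsDomain (⊥ : Subalgebra R X) :=
  (Algebra.botEquivOfInjective hX.algebraMap_injective).toMulEquiv.isDomain R

end Specker

/-! ### The algebra generated by all indicator functions on a set -/

section Indicator

variable (R : Type*) [CommRing R] (P K : Type*) [CommRing K] [Algebra R K]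

/-- The subalgebra of `P → K` generated by its idempotents. If `K` is a domain, these are the
indicator functions of the subsets of `P`. -/
def indicatorAlgebra : Subalgebra R (P → K) :=
  Algebra.adjoin R {e | IsIdempotentElem e}

variable {P K}

lemma mem_indicatorAlgebra {e : P → K} (he : IsIdempotentElem e) : e ∈ indicatorAlgebra R P K :=
  Algebra.subset_adjoin he

variable [IsDomain K]

variable {R} in
lemma isSpeckerAlgebra_indicatorAlgebra (hK : Function.Injective (algebraMap R K)) :
    IsSpeckerAlgebra R (indicatorAlgebra R P K) := by
  refine ⟨⊤, ?_, ?_⟩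
  · rw [← top_le_iff]
    refine (Algebra.adjoin_adjoin_coe_preimage
      (R := R) (s := {e : P → K | IsIdempotentElem e})).ge.trans ?_
    apply Algebra.adjoin_mono
    intro e he
    exact ⟨⟨e, Subtype.ext he⟩, BooleanSubalgebra.mem_top, rfl⟩
  · rintro ⟨⟨e, hmem⟩, he⟩ - hne
    refine ⟨hne, fun a ha => ?_⟩
    have he' : e * e = e := congrArg Subtype.val he
    have ha' : a • e = 0 := congrArg Subtype.val ha
    obtain ⟨p, hp⟩ : ∃ p, e p ≠ 0 := by
      by_contra! h
      exact hne (Subtype.ext (Subtype.ext (funext h)))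
    have h1 : algebraMap R K a * e p = 0 := by
      rw [← Algebra.smul_def]
      exact congrFun ha' p
    exact (injective_iff_map_eq_zero _).mp hK a ((mul_eq_zero.mp h1).resolve_right hp)

lemma isBaerRing_indicatorAlgebra : IsBaerRing (indicatorAlgebra R P K) := by
  classical
  intro I
  let e : P → K := fun p => if ∀ s ∈ I, (s : P → K) p = 0 then 1 else 0
  have he : IsIdempotentElem e := by
    funext p
    simp [e]
  refine ⟨⟨e, mem_indicatorAlgebra R he⟩, Subtype.ext he, Set.ext fun x => ?_⟩
  rw [Set.mem_ofPred_eq, SetLike.mem_coe, Ideal.mem_span_singleton]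
  constructor
  · intro hx
    refine ⟨x, Subtype.ext (funext fun p => ?_)⟩
    change (x : P → K) p = e p * (x : P → K) p
    by_cases h : ∀ s ∈ I, (s : P → K) p = 0
    · simp only [e, if_pos h, one_mul]
    · obtain ⟨s, hs, hsp⟩ : ∃ s ∈ I, (s : P → K) p ≠ 0 := by push Not at h; exact h
      have h0 : (x : P → K) p * (s : P → K) p = 0 :=
        congrFun (congrArg Subtype.val (hx s hs)) p
      rw [(mul_eq_zero.mp h0).resolve_right hsp, mul_zero]
  · rintro ⟨y, rfl⟩ s hs
    refine Subtype.ext (funext fun p => ?_)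
    change e p * (y : P → K) p * (s : P → K) p = 0
    by_cases h : ∀ s ∈ I, (s : P → K) p = 0
    · rw [h s hs, mul_zero]
    · simp only [e, if_neg h, zero_mul]

end Indicator

/-! ### Embedding a Specker algebra in a Baer Specker algebra -/

lemma isBaerRing_of_isDomain (K : Type*) [CommRing K] [IsDomain K] : IsBaerRing K := by
  intro I
  by_cases h : ∀ s ∈ I, s = 0
  · refine ⟨1, .one, Set.ext fun x => ?_⟩
    simp only [Set.mem_ofPred_eq, Ideal.span_singleton_one, Submodule.top_coe, Set.mem_univ,
      iff_true]
    intro s hs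
    rw [h s hs, mul_zero]
  · push Not at h
    obtain ⟨s, hs, hs0⟩ := h
    refine ⟨0, .zero, Set.ext fun x => ?_⟩
    simp only [Set.mem_ofPred_eq, SetLike.mem_coe, Ideal.mem_span_singleton, zero_dvd_iff]
    refine ⟨fun hx => (mul_eq_zero.mp (hx s hs)).resolve_right hs0, ?_⟩
    rintro rfl t -
    exact zero_mul t

lemma IsBaerRing.of_retract {S Y : Type*} [CommRing S] [CommRing Y] (hY : IsBaerRing Y)
    (f : S →+* Y) (ρ : Y →+* S) (h : ∀ s, ρ (f s) = s) : IsBaerRing S := by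
  intro I
  obtain ⟨e, he, hann⟩ := hY (f '' I)
  have mem_iff : ∀ y : Y, (∀ s ∈ I, y * f s = 0) ↔ e ∣ y := by
    intro y
    have := Set.ext_iff.mp hann y
    simpa [Ideal.mem_span_singleton] using this
  refine ⟨ρ e, he.map ρ, Set.ext fun x => ?_⟩
  rw [Set.mem_ofPred_eq, SetLike.mem_coe, Ideal.mem_span_singleton]
  constructor
  · intro hx
    have : e ∣ f x := (mem_iff _).mp fun s hs => by rw [← map_mul, hx s hs, map_zero]
    simpa [h] using map_dvd ρ this
  · rintro ⟨y, rfl⟩ s hs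
    have : ρ (e * f s) = 0 := by rw [(mem_iff e).mpr dvd_rfl s hs, map_zero]
    rw [map_mul, h] at this
    linear_combination y * this

section Embedding

variable {R : Type*} [CommRing R] [IsDomain R] {S : Type*} [CommRing S] [Algebra R S]

/-- Homomorphisms from a Specker algebra to its subalgebra of scalars separate points. -/
lemma IsSpeckerAlgebra.exists_algHom_ne_zero [Nontrivial S] (hS : IsSpeckerAlgebra R S) {x : S}
    (hx : x ≠ 0) : ∃ φ : S →ₐ[R] (⊥ : Subalgebra R S), φ x ≠ 0 := by
  have := hS.isDomain_bot
  obtain ⟨d, -, hfaith, r, hr, hxd⟩ := hS.exists_mul_eq_smul hx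
  -- The partial homomorphism sending `y` to the scalar by which it acts on `d`, if there is one.
  let G : Subalgebra R (S × (⊥ : Subalgebra R S)) :=
    { carrier := {p | p.1 * d = p.2 * d}
      mul_mem' := by
        rintro ⟨a, s⟩ ⟨b, t⟩ (h : a * d = s * d) (h' : b * d = t * d)
        change a * b * d = (s * t : S) * d
        linear_combination b * h + s * h'
      add_mem' := by
        rintro ⟨a, s⟩ ⟨b, t⟩ (h : a * d = s * d) (h' : b * d = t * d)
        change (a + b) * d = (s + t : S) * d
        linear_combination h + h'
      algebraMap_mem' := fun r => rfl }
  have hG : IsSingleValued G := by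
    rintro ⟨s, hs⟩ (h : 0 * d = s * d)
    obtain ⟨a, rfl⟩ := Algebra.mem_bot.mp hs
    rw [zero_mul, ← Algebra.smul_def] at h
    exact Subtype.ext ((congrArg (algebraMap R S) (hfaith a h.symm)).trans (map_zero _))
  obtain ⟨φ, hφ⟩ := exists_algHom_of_isBaerRing (isBaerRing_of_isDomain _)
    hS.adjoin_isIdempotentElem hG
  refine ⟨φ, ?_⟩
  have h1 : (x, algebraMap R (⊥ : Subalgebra R S) r) ∈ G := hxd.trans (Algebra.smul_def r d)
  rw [hφ _ h1]
  intro h0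
  exact hr (hS.algebraMap_injective ((congrArg Subtype.val h0).trans (map_zero _).symm))

/-- Evaluation at the homomorphisms to the scalars, as a map to functions on these homomorphisms. -/
def evalHom (hS : IsSpeckerAlgebra R S) :
    S →ₐ[R] indicatorAlgebra R (S →ₐ[R] (⊥ : Subalgebra R S)) (⊥ : Subalgebra R S) :=
  (AlgHom.pi fun φ : S →ₐ[R] (⊥ : Subalgebra R S) => φ).codRestrict _ <| by
    intro x
    rw [← Subalgebra.mem_comap]
    refine (?_ : (⊤ : Subalgebra R S) ≤ _) trivial
    rw [← hS.adjoin_isIdempotentElem, Algebra.adjoin_le_iff]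
    intro e he
    exact mem_indicatorAlgebra R (funext fun φ => (IsIdempotentElem.map he φ).eq)

lemma evalHom_injective [Nontrivial S] (hS : IsSpeckerAlgebra R S) :
    Function.Injective (evalHom hS) := by
  rw [injective_iff_map_eq_zero]
  intro x hx
  by_contra hx0
  obtain ⟨φ, hφ⟩ := hS.exists_algHom_ne_zero hx0
  exact hφ (congrFun (congrArg Subtype.val hx) φ)

end Embedding

/-! ### Monomorphisms of Specker algebras -/

section Mono

/-- The homomorphism `K × K → X` that sends `(1, 0)` to the idempotent `e`, with `K × K` written
as the functions on `Bool` and `K` the subalgebra of scalars of `X`. -/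
def idempotentHom {R : Type*} [CommRing R] {X : Type*} [CommRing X] [Algebra R X] {e : X}
    (he : IsIdempotentElem e) : (Bool → (⊥ : Subalgebra R X)) →ₐ[R] X :=
  AlgHom.ofLinearMap
    { toFun := fun φ => φ true * e + φ false * (1 - e)
      map_add' := fun φ ψ => by
        simp only [Pi.add_apply, Subalgebra.coe_add]
        ring
      map_smul' := fun r φ => by
        simp only [Pi.smul_apply, Subalgebra.coe_smul, smul_add, smul_mul_assoc,
          RingHom.id_apply] }
    (by simp)
    (fun φ ψ => by
      simp only [LinearMap.coe_mk, AddHom.coe_mk, Pi.mul_apply, Subalgebra.coe_mul]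
      linear_combination ((φ true : X) * ψ false + φ false * ψ true
        - φ true * ψ true - φ false * ψ false) * he.eq)

variable {R : Type u} [CommRing R]

lemma injective_of_mono [IsDomain R] {X Y : SpeckerAlgCat.{v, u} R} (f : X ⟶ Y) [Mono f] :
    Function.Injective f.hom.hom := by
  refine X.property.injective_of_idempotents Y.property f.hom.hom fun e he hfe => ?_
  rcases subsingleton_or_nontrivial X.obj with _ | _
  · exact Subsingleton.elim _ _
  have := X.property.isDomain_bot
  let K := (⊥ : Subalgebra R X.obj)
  have hK : Function.Injective (algebraMap R K) := fun a b h =>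
    X.property.algebraMap_injective (congrArg Subtype.val h)
  let T : SpeckerAlgCat.{v, u} R :=
    ⟨CommAlgCat.of R (indicatorAlgebra R Bool K), isSpeckerAlgebra_indicatorAlgebra hK⟩
  let toX (e : X.obj) (he : IsIdempotentElem e) : T ⟶ X := ObjectProperty.homMk
    (CommAlgCat.ofHom ((idempotentHom (R := R) he).comp (indicatorAlgebra R Bool K).val))
  have hu : toX e he = toX 0 .zero := by
    rw [← cancel_mono f]
    apply ObjectProperty.hom_ext
    apply CommAlgCat.hom_ext
    refine AlgHom.ext fun φ => ?_
    change f.hom.hom ((φ : Bool → K) true * e + (φ : Bool → K) false * (1 - e)) =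
      f.hom.hom ((φ : Bool → K) true * 0 + (φ : Bool → K) false * (1 - 0))
    simp only [map_add, map_mul, map_sub, map_one, map_zero, hfe]
  let δ : Bool → K := fun b => if b then 1 else 0
  have hδ : IsIdempotentElem δ := by
    funext b
    cases b <;> simp [δ]
  have h := DFunLike.congr_fun (congrArg (fun g : T ⟶ X => g.hom.hom) hu)
    ⟨δ, mem_indicatorAlgebra R hδ⟩
  change ((1 : K) : X.obj) * e + ((0 : K) : X.obj) * (1 - e) =
    ((1 : K) : X.obj) * 0 + ((0 : K) : X.obj) * (1 - 0) at h
  simpa using h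

lemma mono_of_injective {X Y : SpeckerAlgCat.{v, u} R} (f : X ⟶ Y)
    (hf : Function.Injective f.hom.hom) : Mono f where
  right_cancellation g h w := by
    apply ObjectProperty.hom_ext
    apply CommAlgCat.hom_ext
    refine AlgHom.ext fun x => hf ?_
    exact DFunLike.congr_fun (congrArg (fun k => k.hom.hom) w) x

end Mono

end Specker

open Specker in
theorem corollary4p8 (R : Type u) [CommRing R] [IsDomain R]
    (S : Specker.SpeckerAlgCat.{v, u} R) :
    Injective S ↔ Specker.IsBaerRing S.obj := by
  constructor
  · intro hS
    rcases subsingleton_or_nontrivial S.obj with _ | _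
    · exact fun I => ⟨0, .zero, Set.ext fun x => by
        simp [Subsingleton.elim x 0]⟩
    have := S.property.isDomain_bot
    let K := (⊥ : Subalgebra R S.obj)
    have hK : Function.Injective (algebraMap R K) := fun a b h =>
      S.property.algebraMap_injective (congrArg Subtype.val h)
    let Y : Specker.SpeckerAlgCat.{v, u} R :=
      ⟨CommAlgCat.of R (indicatorAlgebra R (S.obj →ₐ[R] K) K),
        isSpeckerAlgebra_indicatorAlgebra hK⟩
    let f : S ⟶ Y := ObjectProperty.homMk (CommAlgCat.ofHom (evalHom S.property))
    have : Mono f := mono_of_injective f (evalHom_injective S.property)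
    obtain ⟨ρ, hρ⟩ := hS.factors (𝟙 S) f
    refine (isBaerRing_indicatorAlgebra R).of_retract (f.hom.hom : S.obj →+* Y.obj)
      (ρ.hom.hom : Y.obj →+* S.obj) fun s => ?_
    exact DFunLike.congr_fun (congrArg (fun k => k.hom.hom) hρ) s
  · intro hS
    refine ⟨fun {X Y} g f _ => ?_⟩
    obtain ⟨h, hh⟩ := exists_extension_of_isBaerRing hS Y.property.adjoin_isIdempotentElem
      f.hom.hom (injective_of_mono f) g.hom.hom
    exact ⟨ObjectProperty.homMk (CommAlgCat.ofHom h),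
      ObjectProperty.hom_ext _ (CommAlgCat.hom_ext hh)⟩
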